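/- **Setting.** Let $Y=AX+\sigma W$, where $A$ is an injective real $m\times d$ matrix with spectral norm $\|A\|=1$, $X$ is a random vector in $\mathbb R^d$ with $\|X\|_{\psi_2}=1$ whose (noncentered) covariance matrix $\Sigma_X=\mathbb E[X\otimes X]$ has rank $h$, $W$ is a centered random vector in $\mathbb R^m$ independent of $X$ with $\|W\|_{\psi_2}=1/\sqrt2$, and $0<\sigma<\sqrt2$. Here $\|\xi\|_{\psi_2}=\sup_{\|v\|=1}\sup_{q\ge1}q^{-1/2}\,\mathbb E[|\langle\xi,v\rangle|^q]^{1/q}$. Let $Y_i=AX_i+\sigma W_i$, $i=1,\dots,n$, be independent, each pair $(X_i,W_i)$ being distributed as $(X,W)$, and let $\widehat\Sigma=\frac1n\sum_{i=1}^nY_i\otimes Y_i$. Let $\lambda_{\min}$ be the smallest nonzero eigenvalue of $\Sigma_{AX}=\mathbb E[AX\otimes AX]$, let $\Pi$ be the orthogonal projection onto the range of $\Sigma_{AX}$, and let $\widehat\Pi$ be the orthogonal projection onto the span of the first $h$ vectors of an orthonormal basis of eigenvectors of $\widehat\Sigma$, the corresponding eigenvalues $\widehat\beta_1\ge\dots\ge\widehat\beta_m$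 being repeated according to multiplicity. **Theorem 3.2.** There are absolute constants $C_1,C_2>0$ (independent of $m,d,h,n,A,\sigma,\tau$ and of the distributions of $X$ and $W$) such that for every $\tau>0$, if $$n\ \ge\ C_1(\sqrt m+\tau)^2\max\Big\{\frac{64}{\lambda_{\min}^2},1\Big\}\qquad\text{and}\qquad \sigma^2<\frac{\lambda_{\min}}8,$$ then with probability greater than $1-2e^{-\tau^2}$ the following hold simultaneously, for every choice of the eigenbasis in the definition of $\widehat\Pi$: * $\widehat\beta_i>\lambda_{\min}/2$ for all $i\le h$ and $\widehat\beta_i<\lambda_{\min}/2$ for all $h<i\le m$ (spectral gap); * $\widehat\Pi$ coincides with the orthogonal projection onto the span of the eigenvectors of $\widehat\Sigma$ with eigenvalue greater than $\lambda_{\min}/2$; * $\displaystyle\|\widehat\Pi-\Pi\|\le\frac{C_2}{\lambda_{\min}}\Big(\sqrt{\frac mn}+\frac{\tau}{\sqrt n}+\sigma^2\Big)$, in the spectral norm. -/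

import Mathlib

open MeasureTheory ProbabilityTheory
open scoped ENNReal Matrix.Norms.L2Operator

noncomputable section

namespace InvProblem

/-- The sub-gaussian norm of a random vector `ξ` in `ℝᵏ`:
`sup_{‖v‖ = 1} sup_{q ≥ 1} q^{-1/2} (E |⟨ξ, v⟩|^q)^{1/q}`, with values in `[0, ∞]`. -/
def psi2Norm {Ω : Type*} [MeasurableSpace Ω] (P : Measure Ω) {k : ℕ}
    (ξ : Ω → EuclideanSpace ℝ (Fin k)) : ℝ≥0∞ :=
  ⨆ v ∈ Metric.sphere (0 : EuclideanSpace ℝ (Fin k)) 1, ⨆ q ∈ Set.Ici (1 : ℝ),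
    ENNReal.ofReal (q ^ (-(1 / 2) : ℝ)) *
      eLpNorm (fun ω => inner ℝ (ξ ω) v) (ENNReal.ofReal q) P

/-- The noncentered covariance matrix `Σ_ξ = E[ξ ⊗ ξ]`. -/
def cov {Ω : Type*} [MeasurableSpace Ω] (P : Measure Ω) {k : ℕ}
    (ξ : Ω → EuclideanSpace ℝ (Fin k)) : Matrix (Fin k) (Fin k) ℝ :=
  Matrix.of fun i j => ∫ ω, ξ ω i * ξ ω j ∂P

/-- The empirical covariance matrix `n⁻¹ ∑ᵢ yᵢ ⊗ yᵢ`. -/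
def empCov {m n : ℕ} (y : Fin n → EuclideanSpace ℝ (Fin m)) : Matrix (Fin m) (Fin m) ℝ :=
  (n : ℝ)⁻¹ • ∑ i, Matrix.vecMulVec (y i).ofLp (y i).ofLp

/-- The random vector `A ξ`. -/
def applyMat {Ω : Type*} {m d : ℕ} (A : Matrix (Fin m) (Fin d) ℝ)
    (ξ : Ω → EuclideanSpace ℝ (Fin d)) : Ω → EuclideanSpace ℝ (Fin m) :=
  fun ω => Matrix.toEuclideanLin A (ξ ω)

/-- The noisy datum `A ξ + σ ζ`. -/
def datum {Ω : Type*} {m d : ℕ} (A : Matrix (Fin m) (Fin d) ℝ) (σ : ℝ)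
    (ξ : Ω → EuclideanSpace ℝ (Fin d)) (ζ : Ω → EuclideanSpace ℝ (Fin m)) :
    Ω → EuclideanSpace ℝ (Fin m) :=
  fun ω => Matrix.toEuclideanLin A (ξ ω) + σ • ζ ω

/-- The assumptions on the statistical linear inverse problem `Y = A X + σ W`. The norm of `A` is
its spectral norm, and `h` is the rank of the covariance matrix of the signal. -/
structure IsInverseProblem {Ω : Type*} [MeasurableSpace Ω] (P : Measure Ω) {m d : ℕ}
    (A : Matrix (Fin m) (Fin d) ℝ) (X : Ω → EuclideanSpace ℝ (Fin d))
    (W : Ω → EuclideanSpace ℝ (Fin m)) (σ : ℝ) (h : ℕ) : Prop where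
  injective_A : Function.Injective (Matrix.toEuclideanLin A)
  norm_A : ‖A‖ = 1
  measurable_X : Measurable X
  psi2_X : psi2Norm P X = 1
  measurable_W : Measurable W
  psi2_W : psi2Norm P W = ENNReal.ofReal (1 / √2)
  centered_W : ∫ ω, W ω ∂P = 0
  indep : IndepFun X W P
  sigma_pos : 0 < σ
  sigma_lt : σ < √2
  rank_cov_X : (cov P X).rank = h

/-- The orthogonal projection onto the range of the matrix `S`. -/
def rangeProj {k : ℕ} (S : Matrix (Fin k) (Fin k) ℝ) :
    EuclideanSpace ℝ (Fin k) →L[ℝ] EuclideanSpace ℝ (Fin k) :=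
  (LinearMap.range (Matrix.toEuclideanLin S)).starProjection

/-- The orthogonal projection onto the span of the eigenvectors of `S` whose eigenvalue is
greater than `c`. -/
def upperProj {k : ℕ} (S : Matrix (Fin k) (Fin k) ℝ) (c : ℝ) :
    EuclideanSpace ℝ (Fin k) →L[ℝ] EuclideanSpace ℝ (Fin k) :=
  (Submodule.span ℝ {v | ∃ μ : ℝ, c < μ ∧
    Module.End.HasEigenvector (Matrix.toEuclideanLin S) μ v}).starProjection

/-- `b` is an orthonormal basis of eigenvectors of `S`, and `β` is the family of corresponding
eigenvalues (repeated according to multiplicity), in nonincreasing order. -/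
structure IsOrderedEigenbasis {k : ℕ} (S : Matrix (Fin k) (Fin k) ℝ)
    (b : OrthonormalBasis (Fin k) ℝ (EuclideanSpace ℝ (Fin k))) (β : Fin k → ℝ) : Prop where
  antitone : Antitone β
  eigen : ∀ i, Matrix.toEuclideanLin S (b i) = β i • b i

/-- The orthogonal projection onto the span of the first `h` vectors of the basis `b`. -/
def firstProj {k : ℕ} (b : OrthonormalBasis (Fin k) ℝ (EuclideanSpace ℝ (Fin k))) (h : ℕ) :
    EuclideanSpace ℝ (Fin k) →L[ℝ] EuclideanSpace ℝ (Fin k) :=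
  (Submodule.span ℝ (b '' {i : Fin k | (i : ℕ) < h})).starProjection

/-- The empirical covariance matrix has an ordered eigenbasis, so a statement about all its
ordered eigenbases is never vacuous. -/
theorem exists_isOrderedEigenbasis_empCov {m n : ℕ} (y : Fin n → EuclideanSpace ℝ (Fin m)) :
    ∃ b β, IsOrderedEigenbasis (empCov y) b β := by
  have hS : (empCov y).IsHermitian := by
    ext i j
    simp [empCov, Matrix.sum_apply, Matrix.vecMulVec_apply, mul_comm]
  have hT := Matrix.isSymmetric_toEuclideanLin_iff.mpr hS
  exact ⟨hT.eigenvectorBasis finrank_euclideanSpace_fin, hT.eigenvalues finrank_euclideanSpace_fin,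
    hT.eigenvalues_antitone _, fun i => hT.apply_eigenvectorBasis _ i⟩

end InvProblem

end

/-! The empirical covariance is a small perturbation of `Σ_AX`, and the gap between 0 and `lam` (the
`λ_min` of the statement) makes eigenvalues and eigenspaces stable.

The perturbation has two parts. Since `W` is centered and independent of `X`, the cross terms vanish
and `Σ_Y = Σ_AX + σ² Σ_W`; the normalization of `W` gives `Σ_W ≤ 1`, so the bias is at most `σ²`
(`norm_cov_datum_sub_le`). The fluctuation of the empirical covariance around `Σ_Y` is controlled by
`exists_event_norm_empCov_sub_cov_le`: for a fixed unit vector `v` the variable `⟨Y, v⟩²` is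
sub-exponential, so its empirical mean obeys a Bernstein inequality; a union bound over a `1/2`-net
of at most `5 ^ m` vectors then controls the operator norm. The sample size and noise conditions put
each part below about `lam / 8`, hence the total `ε` below `lam / 4`.

The rest is deterministic (`IsGapPerturbation`). Weyl's inequalities, proved by intersecting
subspaces of large dimension, put the first `h` eigenvalues above `lam / 2` and the others in `[-ε,
ε]`. A Davis–Kahan argument bounds the distance of the spectral projections by `4 ε / lam`. -/

namespace InvProblem

/-! ### Nets of the sphere and norms of symmetric operators. -/

section Net

variable {E : Type*} [NormedAddCommGroup E]

/-- The unit sphere of a finite-dimensional real normed space has a finite `1/2`-net, of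
cardinality at most `5 ^ dim`. -/
theorem exists_half_net_sphere [NormedSpace ℝ E] [FiniteDimensional ℝ E] :
    ∃ N : Finset E, N.card ≤ 5 ^ Module.finrank ℝ E ∧ (∀ v ∈ N, ‖v‖ = 1) ∧
      ∀ x : E, ‖x‖ = 1 → ∃ v ∈ N, ‖x - v‖ ≤ 1 / 2 := by
  classical
  let Q : ℕ → Prop := fun k => ∃ N : Finset E, N.card = k ∧ (∀ v ∈ N, ‖v‖ = 1) ∧
    ∀ v ∈ N, ∀ w ∈ N, v ≠ w → 1 / 2 < ‖v - w‖
  have hQ : ∀ k, Q k → k ≤ 5 ^ Module.finrank ℝ E := by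
    rintro k ⟨N, rfl, h1, h2⟩
    -- Doubling turns `1/2`-separated unit vectors into `1`-separated vectors in the ball of radius
    -- 2, the normalization of the packing bound `5 ^ dim`.
    have hinj : Function.Injective fun v : E => (2 : ℝ) • v :=
      smul_right_injective E two_ne_zero
    rw [← Finset.card_image_of_injective N hinj]
    apply Besicovitch.card_le_of_separated
    · intro c hc
      obtain ⟨v, hv, rfl⟩ := Finset.mem_image.mp hc
      simp [norm_smul, h1 v hv]
    · intro c hc d hd hcd
      obtain ⟨v, hv, rfl⟩ := Finset.mem_image.mp hc
      obtain ⟨w, hw, rfl⟩ := Finset.mem_image.mp hd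
      have := h2 v hv w hw (fun h => hcd (by rw [h]))
      rw [← smul_sub, norm_smul, Real.norm_ofNat]
      linarith
  have h0 : Q 0 := ⟨∅, by simp⟩
  -- A separated set of maximal cardinality is a net: a point far from all of it could be added.
  obtain ⟨N, hN, h1, h2⟩ := Nat.findGreatest_spec (P := Q)
    (Nat.zero_le (5 ^ Module.finrank ℝ E)) h0
  refine ⟨N, hQ _ ⟨N, rfl, h1, h2⟩, h1, fun x hx => ?_⟩
  by_contra! hc
  have hxN : x ∉ N := fun h => by
    have := hc x h
    rw [sub_self, norm_zero] at this
    norm_num at this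
  have hQ' : Q (insert x N).card := by
    refine ⟨insert x N, rfl, ?_, ?_⟩
    · simpa [hx] using h1
    · intro v hv w hw hvw
      rcases Finset.mem_insert.mp hv with hv | hv <;>
        rcases Finset.mem_insert.mp hw with hw | hw
      · exact absurd (hv.trans hw.symm) hvw
      · exact hv ▸ hc w hw
      · rw [norm_sub_rev]; exact hw ▸ hc v hv
      · exact h2 v hv w hw hvw
  have := Nat.le_findGreatest (hQ _ hQ') hQ'
  rw [Finset.card_insert_of_notMem hxN, hN] at this
  omega

variable [InnerProductSpace ℝ E]

/-- The numerical radius of a symmetric operator is its norm. -/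
theorem norm_apply_le_of_abs_inner_le {T : E →ₗ[ℝ] E} (hT : T.IsSymmetric) {M : ℝ}
    (h : ∀ x, |inner ℝ (T x) x| ≤ M * ‖x‖ ^ 2) (x : E) : ‖T x‖ ≤ M * ‖x‖ := by
  rcases eq_or_ne x 0 with rfl | hx
  · simp
  have key : ∀ u v : E, 4 * inner ℝ (T u) v ≤ 2 * M * (‖u‖ ^ 2 + ‖v‖ ^ 2) := by
    intro u v
    have e : 4 * inner ℝ (T u) v =
        inner ℝ (T (u + v)) (u + v) - inner ℝ (T (u - v)) (u - v) := by
      have := (hT v u).trans (real_inner_comm _ _)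
      simp only [map_add, map_sub, inner_add_left, inner_add_right, inner_sub_left,
        inner_sub_right]
      linarith
    have p := parallelogram_law_with_norm ℝ u v
    have h1 := (abs_le.mp (h (u + v))).2
    have h2 := (abs_le.mp (h (u - v))).1
    have h3 : M * ‖u + v‖ ^ 2 + M * ‖u - v‖ ^ 2 = 2 * M * (‖u‖ ^ 2 + ‖v‖ ^ 2) := by
      rw [← mul_add, p]
      ring
    linarith
  have hx' : 0 < ‖x‖ := norm_pos_iff.mpr hx
  rcases eq_or_ne (T x) 0 with h0 | h0
  · rw [h0, norm_zero]
    have := (abs_nonneg _).trans (h x)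
    by_contra! hc
    nlinarith
  have hy : 0 < ‖T x‖ := norm_pos_iff.mpr h0
  -- The scaling gives both vectors the norm `‖x‖ * ‖T x‖`, the balanced case of `key`.
  have k := key (‖T x‖ • x) (‖x‖ • T x)
  simp only [map_smul, inner_smul_left, inner_smul_right, norm_smul, norm_norm,
    real_inner_self_eq_norm_sq, RCLike.conj_to_real] at k
  have hpos : 0 < 4 * ‖T x‖ ^ 2 * ‖x‖ := by positivity
  refine le_of_mul_le_mul_left ?_ hpos
  nlinarith

/-- The norm of a symmetric operator is controlled by its quadratic form on a `1/2`-net of the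
sphere. -/
theorem norm_apply_le_of_net [FiniteDimensional ℝ E] {T : E →ₗ[ℝ] E} (hT : T.IsSymmetric)
    {N : Set E} (hN : ∀ x : E, ‖x‖ = 1 → ∃ v ∈ N, ‖x - v‖ ≤ 1 / 2) (hN1 : ∀ v ∈ N, ‖v‖ = 1)
    {t : ℝ} (h : ∀ v ∈ N, |inner ℝ (T v) v| ≤ t) (x : E) : ‖T x‖ ≤ 32 * t * ‖x‖ := by
  set M := ‖T.toContinuousLinearMap‖ with hM
  have hMx : ∀ x, ‖T x‖ ≤ M * ‖x‖ := fun x => T.toContinuousLinearMap.le_opNorm x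
  have hM0 : 0 ≤ M := norm_nonneg _
  have h1 : ∀ x : E, ‖x‖ = 1 → |inner ℝ (T x) x| ≤ t + 31 / 32 * M := by
    intro x hx
    obtain ⟨v, hv, hxv⟩ := hN x hx
    have e : inner ℝ (T x) x = inner ℝ (T v) v + inner ℝ (T (x + v)) (x - v) := by
      have := (hT x v).trans (real_inner_comm _ _)
      simp only [map_add, inner_add_left, inner_sub_right]
      linarith
    have p := parallelogram_law_with_norm ℝ x v
    rw [hx, hN1 v hv] at p
    -- With `s = ‖x - v‖ ^ 2 ≤ 1 / 4`, the squared product is `(4 - s) * s ≤ 15 / 16 < (31 / 32) ^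
    -- 2`.
    have hprod : ‖x + v‖ * ‖x - v‖ ≤ 31 / 32 := by
      have h0 := norm_nonneg (x - v)
      have h00 := norm_nonneg (x + v)
      have h2 : ‖x - v‖ ^ 2 ≤ 1 / 4 := by nlinarith
      apply abs_le_of_sq_le_sq' _ (by norm_num) |>.2
      rw [mul_pow]
      have : ‖x + v‖ ^ 2 = 4 - ‖x - v‖ ^ 2 := by nlinarith
      rw [this]
      nlinarith
    have h3 : |inner ℝ (T (x + v)) (x - v)| ≤ 31 / 32 * M := by
      refine (abs_real_inner_le_norm _ _).trans ?_
      have := hMx (x + v)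
      calc ‖T (x + v)‖ * ‖x - v‖ ≤ M * ‖x + v‖ * ‖x - v‖ := by gcongr
        _ = M * (‖x + v‖ * ‖x - v‖) := by ring
        _ ≤ M * (31 / 32) := by gcongr
        _ = _ := by ring
    rw [e]
    exact (abs_add_le _ _).trans (add_le_add (h v hv) h3)
  have h2 : ∀ x, |inner ℝ (T x) x| ≤ (t + 31 / 32 * M) * ‖x‖ ^ 2 := by
    intro x
    rcases eq_or_ne x 0 with rfl | hx
    · simp
    have hx' : 0 < ‖x‖ := norm_pos_iff.mpr hx
    have := h1 (‖x‖⁻¹ • x) (by simp [norm_smul, hx'.ne'])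
    simp only [map_smul, inner_smul_left, inner_smul_right, RCLike.conj_to_real, abs_mul,
      abs_inv, abs_norm] at this
    field_simp at this
    linarith
  rcases eq_or_ne x 0 with rfl | hx
  · simp
  have ht : 0 ≤ t + 31 / 32 * M := by
    have := (abs_nonneg _).trans (h2 x)
    have hx' : 0 < ‖x‖ := norm_pos_iff.mpr hx
    by_contra! hc
    nlinarith [sq_pos_of_pos hx']
  -- `M` is finite, so the term `31 / 32 * M` can be absorbed on the left; this produces the factor
  -- 32.
  have hMle : M ≤ t + 31 / 32 * M :=
    ContinuousLinearMap.opNorm_le_bound _ ht (norm_apply_le_of_abs_inner_le hT h2)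
  have : M ≤ 32 * t := by linarith
  exact (hMx x).trans (by gcongr)

end Net

/-! ### Spectral perturbation across a gap: Weyl and Davis–Kahan bounds. -/

section Perturbation

variable {V : Type*} [NormedAddCommGroup V] [InnerProductSpace ℝ V] {m : ℕ}

/-- On its range, a symmetric operator is bounded below by its smallest nonzero eigenvalue. -/
theorem le_inner_of_mem_range [FiniteDimensional ℝ V] {T : V →ₗ[ℝ] V} (hT : T.IsSymmetric)
    {lam : ℝ} (hlam : ∀ μ : ℝ, μ ≠ 0 → Module.End.HasEigenvalue T μ → lam ≤ μ)
    {x : V} (hx : x ∈ LinearMap.range T) : lam * ‖x‖ ^ 2 ≤ inner ℝ (T x) x := by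
  obtain ⟨y, rfl⟩ := hx
  have hn : Module.finrank ℝ V = Module.finrank ℝ V := rfl
  set e := hT.eigenvectorBasis hn
  have hc : ∀ i z, inner ℝ (e i) (T z) = hT.eigenvalues hn i * inner ℝ (e i) z := by
    intro i z
    rw [← hT, hT.apply_eigenvectorBasis, inner_smul_left]
    rfl
  rw [← e.sum_inner_mul_inner (T (T y)), ← e.sum_sq_norm_inner_right, Finset.mul_sum]
  refine Finset.sum_le_sum fun i _ => ?_
  rw [real_inner_comm (e i) (T (T y)), hc i (T y), Real.norm_eq_abs, sq_abs]
  -- A vector of the range has no component along eigenvectors of eigenvalue 0; all other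
  -- eigenvalues are at least `lam`.
  rcases eq_or_ne (hT.eigenvalues hn i) 0 with h0 | h0
  · rw [hc i y, h0]; simp
  · have := hlam _ h0 (hT.hasEigenvalue_eigenvalues hn i)
    nlinarith [sq_nonneg (inner ℝ (e i) (T y))]

/-- Two subspaces whose dimensions add up to more than the dimension of the space have a common
nonzero vector. -/
theorem exists_ne_zero_mem_of_finrank_lt {E : Type*} [AddCommGroup E] [Module ℝ E]
    [FiniteDimensional ℝ E] (U U' : Submodule ℝ E)
    (h : Module.finrank ℝ E < Module.finrank ℝ U + Module.finrank ℝ U') :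
    ∃ x ∈ U, x ∈ U' ∧ x ≠ 0 := by
  by_contra! hc
  have hd : Disjoint U U' := by
    rw [Submodule.disjoint_def]
    exact fun x hx hx' => hc x hx hx'
  exact absurd (Submodule.finrank_add_finrank_le_of_disjoint hd) (by omega)

theorem finrank_span_image_basis (b : OrthonormalBasis (Fin m) ℝ V) (s : Finset (Fin m)) :
    Module.finrank ℝ (Submodule.span ℝ (b '' s)) = s.card := by
  classical
  have hb := b.orthonormal.linearIndependent
  rw [← Finset.coe_image, finrank_span_finset_eq_card, Finset.card_image_of_injective _ hb.injective]
  rw [Finset.coe_image]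
  exact (hb.linearIndepOn s).id_image

theorem inner_basis_eq_zero_of_mem_span {b : OrthonormalBasis (Fin m) ℝ V} {s : Set (Fin m)}
    {x : V} (hx : x ∈ Submodule.span ℝ (b '' s)) {i : Fin m} (hi : i ∉ s) :
    inner ℝ (b i) x = 0 := by
  induction hx using Submodule.span_induction with
  | mem x hx =>
    obtain ⟨j, hj, rfl⟩ := hx
    exact b.orthonormal.inner_eq_zero fun h => hi (h ▸ hj)
  | zero => simp
  | add x y _ _ hx hy => rw [inner_add_right, hx, hy, add_zero]
  | smul a x _ hx => rw [inner_smul_right, hx, mul_zero]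

theorem mem_span_of_inner_basis_eq_zero {b : OrthonormalBasis (Fin m) ℝ V} {s : Set (Fin m)}
    {x : V} (hx : ∀ i ∉ s, inner ℝ (b i) x = 0) : x ∈ Submodule.span ℝ (b '' s) := by
  rw [← b.sum_repr' x]
  refine Submodule.sum_mem _ fun i _ => ?_
  by_cases hi : i ∈ s
  · exact Submodule.smul_mem _ _ (Submodule.subset_span ⟨i, hi, rfl⟩)
  · simp [hx i hi]

theorem inner_basis_apply {T : V →ₗ[ℝ] V} (hT : T.IsSymmetric)
    {b : OrthonormalBasis (Fin m) ℝ V} {β : Fin m → ℝ} (hb : ∀ i, T (b i) = β i • b i)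
    (i : Fin m) (x : V) : inner ℝ (b i) (T x) = β i * inner ℝ (b i) x := by
  rw [← hT, hb, inner_smul_left]
  rfl

theorem inner_apply_eq_sum {T : V →ₗ[ℝ] V} (hT : T.IsSymmetric)
    {b : OrthonormalBasis (Fin m) ℝ V} {β : Fin m → ℝ} (hb : ∀ i, T (b i) = β i • b i)
    (x : V) : inner ℝ (T x) x = ∑ i, β i * inner ℝ (b i) x ^ 2 := by
  rw [← b.sum_inner_mul_inner]
  refine Finset.sum_congr rfl fun i _ => ?_
  rw [real_inner_comm (b i) (T x), inner_basis_apply hT hb]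
  ring

theorem norm_sq_apply_eq_sum {T : V →ₗ[ℝ] V} (hT : T.IsSymmetric)
    {b : OrthonormalBasis (Fin m) ℝ V} {β : Fin m → ℝ} (hb : ∀ i, T (b i) = β i • b i)
    (x : V) : ‖T x‖ ^ 2 = ∑ i, β i ^ 2 * inner ℝ (b i) x ^ 2 := by
  rw [← b.sum_sq_inner_right]
  refine Finset.sum_congr rfl fun i _ => ?_
  rw [inner_basis_apply hT hb, mul_pow]

/-- A positive symmetric operator `T` of rank `h` whose nonzero eigenvalues are at least `lam`,
and a symmetric perturbation `T'` of `T` of size at most `ε`, with an ordered eigenbasis. -/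
structure IsGapPerturbation (T T' : V →ₗ[ℝ] V) (h : ℕ) (lam ε : ℝ)
    (b : OrthonormalBasis (Fin m) ℝ V) (β : Fin m → ℝ) : Prop where
  symm : T.IsSymmetric
  symm' : T'.IsSymmetric
  nonneg : ∀ x, 0 ≤ inner ℝ (T x) x
  lam_le : ∀ μ : ℝ, μ ≠ 0 → Module.End.HasEigenvalue T μ → lam ≤ μ
  lam_pos : 0 < lam
  eps_nonneg : 0 ≤ ε
  eps_lt : ε < lam / 4
  finrank_range : Module.finrank ℝ (LinearMap.range T) = h
  norm_sub_le : ∀ x, ‖T' x - T x‖ ≤ ε * ‖x‖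
  antitone : Antitone β
  eigen : ∀ i, T' (b i) = β i • b i

namespace IsGapPerturbation

variable {T T' : V →ₗ[ℝ] V} {h : ℕ} {lam ε : ℝ} {b : OrthonormalBasis (Fin m) ℝ V}
  {β : Fin m → ℝ}

theorem finrank_eq (_ : IsGapPerturbation T T' h lam ε b β) : Module.finrank ℝ V = m := by
  rw [Module.finrank_eq_card_basis b.toBasis, Fintype.card_fin]

theorem abs_inner_sub_le (H : IsGapPerturbation T T' h lam ε b β) (x : V) :
    |inner ℝ (T' x) x - inner ℝ (T x) x| ≤ ε * ‖x‖ ^ 2 := by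
  rw [← inner_sub_left]
  refine (abs_real_inner_le_norm _ _).trans ?_
  have := mul_le_mul_of_nonneg_right (H.norm_sub_le x) (norm_nonneg x)
  linarith

variable [FiniteDimensional ℝ V]

/-- Weyl's inequality by counting dimensions: the range of `T` (dimension `h`) meets the span of the
`b j` with `j ≥ i` (dimension `m - i > m - h`). On a common vector the form of `T` is at least
`lam`, while that of `T'` would be at most `lam / 2` if the claim failed; they differ by at most `ε
< lam / 4`. -/
theorem lt_eigenvalue (H : IsGapPerturbation T T' h lam ε b β) {i : Fin m} (hi : (i : ℕ) < h) :
    lam / 2 < β i := by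
  by_contra! hc
  have hcard : (Finset.Ici i).card = m - i := by simp
  obtain ⟨x, hx1, hx2, hx0⟩ := exists_ne_zero_mem_of_finrank_lt (LinearMap.range T)
    (Submodule.span ℝ (b '' (Finset.Ici i : Finset (Fin m)))) (by
      rw [H.finrank_range, finrank_span_image_basis, H.finrank_eq, hcard]
      omega)
  have h1 := le_inner_of_mem_range H.symm H.lam_le hx1
  have h2 : inner ℝ (T' x) x ≤ lam / 2 * ‖x‖ ^ 2 := by
    rw [inner_apply_eq_sum H.symm' H.eigen, ← b.sum_sq_inner_right, Finset.mul_sum]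
    refine Finset.sum_le_sum fun j _ => ?_
    by_cases hj : i ≤ j
    · exact mul_le_mul_of_nonneg_right ((H.antitone hj).trans hc) (sq_nonneg _)
    · rw [inner_basis_eq_zero_of_mem_span hx2 (by simpa using hj)]
      simp
  have h3 := (abs_le.mp (H.abs_inner_sub_le x)).1
  have hx : 0 < ‖x‖ ^ 2 := by positivity
  nlinarith [H.eps_lt, H.lam_pos]

/-- The lower bound tests positivity of `T` on `b i`. For the upper bound, the kernel of `T`
(dimension `m - h`) meets the span of the first `i + 1 > h` eigenvectors, where the form of `T'` is
at least `β i`. The bound `ε`, sharper than `lam / 2`, is what the projection estimate needs. -/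
theorem abs_eigenvalue_le (H : IsGapPerturbation T T' h lam ε b β) {i : Fin m}
    (hi : h ≤ (i : ℕ)) : |β i| ≤ ε := by
  rw [abs_le]
  constructor
  · have h1 := (abs_le.mp (H.abs_inner_sub_le (b i))).1
    have h2 := H.nonneg (b i)
    rw [H.eigen, inner_smul_left, real_inner_self_eq_norm_sq, b.norm_eq_one] at h1
    simp only [RCLike.conj_to_real] at h1
    linarith
  · by_contra! hc
    have hcard : (Finset.Iic i).card = i + 1 := by simp
    have hrk := LinearMap.finrank_range_add_finrank_ker T
    rw [H.finrank_range, H.finrank_eq] at hrk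
    obtain ⟨x, hx1, hx2, hx0⟩ := exists_ne_zero_mem_of_finrank_lt (LinearMap.ker T)
      (Submodule.span ℝ (b '' (Finset.Iic i : Finset (Fin m)))) (by
        rw [finrank_span_image_basis, H.finrank_eq, hcard]
        omega)
    have h2 : β i * ‖x‖ ^ 2 ≤ inner ℝ (T' x) x := by
      rw [inner_apply_eq_sum H.symm' H.eigen, ← b.sum_sq_inner_right, Finset.mul_sum]
      refine Finset.sum_le_sum fun j _ => ?_
      by_cases hj : j ≤ i
      · exact mul_le_mul_of_nonneg_right (H.antitone hj) (sq_nonneg _)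
      · rw [inner_basis_eq_zero_of_mem_span hx2 (by simpa using hj)]
        simp
    have h3 := (abs_le.mp (H.abs_inner_sub_le x)).2
    rw [LinearMap.mem_ker.mp hx1, inner_zero_left] at h3
    have hx : 0 < ‖x‖ ^ 2 := by positivity
    nlinarith

theorem eigenvalue_lt (H : IsGapPerturbation T T' h lam ε b β) {i : Fin m}
    (hi : h ≤ (i : ℕ)) : β i < lam / 2 := by
  have := (abs_le.mp (H.abs_eigenvalue_le hi)).2
  linarith [H.eps_lt, H.lam_pos]

/-- An eigenvector with eigenvalue above `lam / 2` is orthogonal to each `b i` with `i ≥ h`, whose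
eigenvalue is different. In particular the span does not depend on the choice of `b`. -/
theorem span_first_eq (H : IsGapPerturbation T T' h lam ε b β) :
    Submodule.span ℝ (b '' {i : Fin m | (i : ℕ) < h}) =
      Submodule.span ℝ {v | ∃ μ : ℝ, lam / 2 < μ ∧ Module.End.HasEigenvector T' μ v} := by
  apply le_antisymm <;> rw [Submodule.span_le]
  · rintro _ ⟨i, hi, rfl⟩
    exact Submodule.subset_span ⟨β i, H.lt_eigenvalue hi,
      Module.End.mem_eigenspace_iff.mpr (H.eigen i), b.orthonormal.ne_zero i⟩
  · rintro v ⟨μ, hμ, hv⟩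
    refine mem_span_of_inner_basis_eq_zero fun i hi => ?_
    have h1 := inner_basis_apply H.symm' H.eigen i v
    rw [hv.apply_eq_smul, inner_smul_right] at h1
    have h2 := H.eigenvalue_lt (not_lt.mp hi)
    have h3 : (μ - β i) * inner ℝ (b i) v = 0 := by linarith
    exact (mul_eq_zero.mp h3).resolve_left (by linarith)

theorem norm_apply_le_of_mem_orthogonal (H : IsGapPerturbation T T' h lam ε b β) {w : V}
    (hw : w ∈ (Submodule.span ℝ (b '' {i : Fin m | (i : ℕ) < h}))ᗮ) : ‖T' w‖ ≤ ε * ‖w‖ := by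
  refine abs_le_of_sq_le_sq ?_ (mul_nonneg H.eps_nonneg (norm_nonneg w)) |> le_of_abs_le
  rw [norm_sq_apply_eq_sum H.symm' H.eigen, mul_pow, ← b.sum_sq_inner_right, Finset.mul_sum]
  refine Finset.sum_le_sum fun i _ => ?_
  rcases lt_or_ge (i : ℕ) h with hi | hi
  · have : inner ℝ (b i) w = 0 := hw _ (Submodule.subset_span ⟨i, hi, rfl⟩)
    simp [this]
  · exact mul_le_mul_of_nonneg_right (sq_le_sq.mpr
      ((H.abs_eigenvalue_le hi).trans (le_abs_self ε))) (sq_nonneg _)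

theorem le_norm_apply_of_mem_span (H : IsGapPerturbation T T' h lam ε b β) {y : V}
    (hy : y ∈ Submodule.span ℝ (b '' {i : Fin m | (i : ℕ) < h})) :
    lam / 2 * ‖y‖ ≤ ‖T' y‖ := by
  have hlam := H.lam_pos
  refine abs_le_of_sq_le_sq ?_ (norm_nonneg _) |> le_of_abs_le
  rw [norm_sq_apply_eq_sum H.symm' H.eigen, mul_pow, ← b.sum_sq_inner_right, Finset.mul_sum]
  refine Finset.sum_le_sum fun i _ => ?_
  rcases lt_or_ge (i : ℕ) h with hi | hi
  · have := H.lt_eigenvalue hi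
    gcongr
  · rw [inner_basis_eq_zero_of_mem_span hy (by simpa using hi)]
    simp

/-- The span is invariant under `T'`, which is bounded below on it, hence injective and, by finite
dimension, surjective. -/
theorem exists_mem_span_apply_eq (H : IsGapPerturbation T T' h lam ε b β) {x : V}
    (hx : x ∈ Submodule.span ℝ (b '' {i : Fin m | (i : ℕ) < h})) :
    ∃ y ∈ Submodule.span ℝ (b '' {i : Fin m | (i : ℕ) < h}), T' y = x := by
  have hlam := H.lam_pos
  have hmaps : ∀ y ∈ Submodule.span ℝ (b '' {i : Fin m | (i : ℕ) < h}),
      T' y ∈ Submodule.span ℝ (b '' {i : Fin m | (i : ℕ) < h}) := by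
    intro y hy
    refine mem_span_of_inner_basis_eq_zero fun i hi => ?_
    rw [inner_basis_apply H.symm' H.eigen, inner_basis_eq_zero_of_mem_span hy hi, mul_zero]
  have hF : Function.Injective (T'.restrict hmaps) := by
    rw [← LinearMap.ker_eq_bot, LinearMap.ker_eq_bot']
    intro y hy
    have h1 := H.le_norm_apply_of_mem_span y.2
    have h2 : T' y = 0 := congrArg Subtype.val hy
    rw [h2, norm_zero] at h1
    have : ‖(y : V)‖ ≤ 0 := by nlinarith
    exact Subtype.ext (norm_le_zero_iff.mp this)
  obtain ⟨y, hy⟩ := LinearMap.surjective_of_injective hF ⟨x, hx⟩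
  exact ⟨y, y.2, congrArg Subtype.val hy⟩

/-- First half of Davis–Kahan. Write `x = T' y` with `‖y‖ ≤ 2 / lam * ‖x‖`; as `T y` lies in the
range of `T`, the residual of `x` is that of `T' y - T y`, of norm at most `ε * ‖y‖`. -/
theorem norm_sub_starProjection_le (H : IsGapPerturbation T T' h lam ε b β) {x : V}
    (hx : x ∈ Submodule.span ℝ (b '' {i : Fin m | (i : ℕ) < h})) :
    ‖x - (LinearMap.range T).starProjection x‖ ≤ 2 * ε / lam * ‖x‖ := by
  set U := LinearMap.range T
  have hlam := H.lam_pos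
  have hε := H.eps_nonneg
  obtain ⟨y, hy, rfl⟩ := H.exists_mem_span_apply_eq hx
  have e : T' y - U.starProjection (T' y) = Uᗮ.starProjection (T' y - T y) := by
    rw [Submodule.starProjection_orthogonal', _root_.sub_apply, one_apply_eq_self, map_sub,
      show U.starProjection (T y) = T y from
        Submodule.starProjection_eq_self_iff.mpr (LinearMap.mem_range_self T y)]
    abel
  rw [e]
  refine ((Uᗮ.norm_starProjection_apply_le _).trans (H.norm_sub_le y)).trans ?_
  rw [div_mul_eq_mul_div, le_div_iff₀ hlam]
  nlinarith [H.le_norm_apply_of_mem_span hy]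

/-- Second half of Davis–Kahan. If `p` is the projection of `w`, then `T p = T w`; this has norm at
least `lam * ‖p‖` by the gap, and at most `2 * ε * ‖w‖` because `T'` is bounded by `ε` on the
complement. -/
theorem norm_starProjection_le (H : IsGapPerturbation T T' h lam ε b β) {w : V}
    (hw : w ∈ (Submodule.span ℝ (b '' {i : Fin m | (i : ℕ) < h}))ᗮ) :
    ‖(LinearMap.range T).starProjection w‖ ≤ 2 * ε / lam * ‖w‖ := by
  set U := LinearMap.range T
  have hlam := H.lam_pos
  have hε := H.eps_nonneg
  set p := U.starProjection w with hp
  have hpU : p ∈ U := U.starProjection_apply_mem w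
  have e : T p = T w := by
    have hk : T (w - p) = 0 := by
      refine ext_inner_right ℝ fun z => ?_
      rw [H.symm, inner_zero_left, real_inner_comm]
      exact U.sub_starProjection_mem_orthogonal w _ (LinearMap.mem_range_self T z)
    rw [map_sub, sub_eq_zero] at hk
    exact hk.symm
  have h3 := le_inner_of_mem_range H.symm H.lam_le hpU
  have h4 := real_inner_le_norm (T p) p
  have h5 : ‖T w‖ ≤ 2 * ε * ‖w‖ := by
    have := norm_le_norm_add_norm_sub' (T w) (T' w)
    rw [norm_sub_rev] at this
    linarith [H.norm_apply_le_of_mem_orthogonal hw, H.norm_sub_le w]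
  rw [e] at h3 h4
  rw [div_mul_eq_mul_div, le_div_iff₀ hlam]
  rcases (norm_nonneg p).eq_or_lt with h0 | h0
  · rw [← h0, zero_mul]; positivity
  · have : lam * ‖p‖ ≤ ‖T w‖ := le_of_mul_le_mul_right (by nlinarith) h0
    linarith

/-- With `Q'`, `Q` the two projections, `Q' - Q = (1 - Q) Q' - Q (1 - Q')`, and each term is at most
`2 * ε / lam`. -/
theorem norm_starProjection_sub_le (H : IsGapPerturbation T T' h lam ε b β) :
    ‖(Submodule.span ℝ (b '' {i : Fin m | (i : ℕ) < h})).starProjection -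
      (LinearMap.range T).starProjection‖ ≤ 4 * ε / lam := by
  set U' := Submodule.span ℝ (b '' {i : Fin m | (i : ℕ) < h}) with hU'
  set U := LinearMap.range T with hU
  have hlam := H.lam_pos
  have hε := H.eps_nonneg
  refine ContinuousLinearMap.opNorm_le_bound _ (by positivity) fun x => ?_
  have k1 := H.norm_sub_starProjection_le (U'.starProjection_apply_mem x)
  have k2 := H.norm_starProjection_le (U'ᗮ.starProjection_apply_mem x)
  have k3 := U'.norm_starProjection_apply_le x
  have k4 := U'ᗮ.norm_starProjection_apply_le x
  have e : (U'.starProjection - U.starProjection) x =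
      (U'.starProjection x - U.starProjection (U'.starProjection x)) -
        U.starProjection (U'ᗮ.starProjection x) := by
    rw [Submodule.starProjection_orthogonal', _root_.sub_apply, _root_.sub_apply, map_sub,
      one_apply_eq_self]
    abel
  rw [e]
  have k5 := mul_le_mul_of_nonneg_left k3 (by positivity : 0 ≤ 2 * ε / lam)
  have k6 := mul_le_mul_of_nonneg_left k4 (by positivity : 0 ≤ 2 * ε / lam)
  have : 4 * ε / lam * ‖x‖ = 2 * ε / lam * ‖x‖ + 2 * ε / lam * ‖x‖ := by ring
  rw [this]
  exact (_root_.norm_sub_le _ _).trans (add_le_add (k1.trans k5) (k2.trans k6))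

end IsGapPerturbation

end Perturbation

/-! ### Moment bounds, exponential moments and a Bernstein inequality. -/

section Scalar

open Real

variable {Ω : Type*} [MeasurableSpace Ω] {P : Measure Ω}

theorem integrable_of_hasSum_of_summable_integral_norm {F : ℕ → Ω → ℝ} {f : Ω → ℝ}
    (hF : ∀ i, Integrable (F i) P) (hs : Summable fun i => ∫ ω, ‖F i ω‖ ∂P)
    (hf : AEStronglyMeasurable f P) (h : ∀ ω, HasSum (fun i => F i ω) (f ω)) :
    Integrable f P := by
  refine ⟨hf, ?_⟩
  have h1 : ∀ ω, ‖f ω‖ₑ ≤ ∑' i, ‖F i ω‖ₑ := fun ω => by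
    rw [← (h ω).tsum_eq]
    exact enorm_tsum_le_tsum_enorm
  refine (lintegral_mono h1).trans_lt ?_
  rw [lintegral_tsum fun i => (hF i).1.enorm]
  have h2 : ∀ i, ∫⁻ ω, ‖F i ω‖ₑ ∂P = ENNReal.ofReal (∫ ω, ‖F i ω‖ ∂P) := fun i =>
    (ofReal_integral_norm_eq_lintegral_enorm (hF i)).symm
  simp_rw [h2]
  exact hs.tsum_ofReal_lt_top

/-- The moment condition `E |U| ^ q ≤ (K √q) ^ q`, `q ≥ 1`, controls the even moments. -/
theorem integral_sq_pow_le {U : Ω → ℝ} (hU : AEStronglyMeasurable U P) {K : ℝ} (hK : 0 ≤ K)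
    (h : ∀ q : ℝ, 1 ≤ q → eLpNorm U (ENNReal.ofReal q) P ≤ ENNReal.ofReal (K * √q))
    {p : ℕ} (hp : 1 ≤ p) :
    Integrable (fun ω => (U ω ^ 2) ^ p) P ∧
      ∫ ω, (U ω ^ 2) ^ p ∂P ≤ (2 * K ^ 2 * p) ^ p := by
  have hp1 : (1 : ℝ) ≤ p := by exact_mod_cast hp
  -- The exponent `q = 2 p` gives `(K √(2 p)) ^ (2 p) = (2 K² p) ^ p`.
  set q : ℝ := 2 * p with hq
  have hq1 : 1 ≤ q := by linarith
  have hmem : MemLp U (ENNReal.ofReal q) P := ⟨hU, (h q hq1).trans_lt ENNReal.ofReal_lt_top⟩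
  have h0 : ENNReal.ofReal q ≠ 0 := by simpa using by linarith
  have hqr : (ENNReal.ofReal q).toReal = q := ENNReal.toReal_ofReal (by linarith)
  have e : ∀ ω, (U ω ^ 2) ^ p = ‖U ω‖ ^ (ENNReal.ofReal q).toReal := fun ω => by
    rw [hqr, hq, show (2 : ℝ) * p = ((2 * p : ℕ) : ℝ) by push_cast; ring, Real.rpow_natCast,
      pow_mul, Real.norm_eq_abs, sq_abs]
  simp_rw [e]
  refine ⟨hmem.integrable_norm_rpow h0 ENNReal.ofReal_ne_top, ?_⟩
  have h1 := h q hq1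
  rw [hmem.eLpNorm_eq_integral_rpow_norm h0 ENNReal.ofReal_ne_top,
    ENNReal.ofReal_le_ofReal_iff (by positivity)] at h1
  have hI : 0 ≤ ∫ ω, ‖U ω‖ ^ (ENNReal.ofReal q).toReal ∂P :=
    integral_nonneg fun ω => by positivity
  rw [hqr] at h1 hI ⊢
  have h2 := Real.rpow_le_rpow (by positivity) h1 (by linarith : 0 ≤ q)
  rw [← Real.rpow_mul hI, inv_mul_cancel₀ (by linarith), Real.rpow_one] at h2
  refine h2.trans (le_of_eq ?_)
  rw [hq, show (2 : ℝ) * p = ((2 * p : ℕ) : ℝ) by push_cast; ring, Real.rpow_natCast,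
    pow_mul, mul_pow, Real.sq_sqrt (by positivity)]
  push_cast
  ring

/-- A nonnegative random variable with `E Z ^ p ≤ (a p) ^ p` is sub-exponential. -/
theorem mgf_le_of_integral_pow_le [IsProbabilityMeasure P] {Z : Ω → ℝ}
    (hZm : AEStronglyMeasurable Z P) (hZ : ∀ ω, 0 ≤ Z ω) {a : ℝ} (ha : 0 ≤ a)
    (hint : ∀ p : ℕ, 1 ≤ p → Integrable (fun ω => Z ω ^ p) P)
    (hle : ∀ p : ℕ, 1 ≤ p → ∫ ω, Z ω ^ p ∂P ≤ (a * p) ^ p)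
    {s : ℝ} (hs : |s| * a * exp 1 ≤ 1 / 2) :
    Integrable (fun ω => exp (s * Z ω)) P ∧
      mgf Z P s ≤ exp (s * ∫ ω, Z ω ∂P + 2 * (s * a * exp 1) ^ 2) := by
  set r := |s| * a * exp 1 with hr
  have hr0 : 0 ≤ r := by positivity
  -- The exponential is integrated term by term; `p ^ p / p! ≤ e ^ p` bounds the term of order `p`
  -- by `r ^ p`.
  let F : ℕ → Ω → ℝ := fun p ω => (s * Z ω) ^ p / p.factorial
  have hFi : ∀ p, Integrable (F p) P := by
    intro p
    rcases Nat.eq_zero_or_pos p with rfl | hp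
    · simp [F]
    · simp only [F, mul_pow]
      exact ((hint p hp).const_mul _).div_const _
  have hFn : ∀ p, ∫ ω, ‖F p ω‖ ∂P ≤ r ^ p := by
    intro p
    rcases Nat.eq_zero_or_pos p with rfl | hp
    · simp [F]
    · have e : ∀ ω, ‖F p ω‖ = |s| ^ p / p.factorial * Z ω ^ p := fun ω => by
        simp only [F, norm_div, norm_pow, norm_mul, Real.norm_eq_abs, abs_of_nonneg (hZ ω),
          Nat.abs_cast]
        ring
      simp_rw [e]
      rw [integral_const_mul]
      have h1 := Real.pow_div_factorial_le_exp (x := (p : ℝ)) (by positivity) p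
      have h2 : exp (p : ℝ) = exp 1 ^ p := by rw [← Real.exp_nat_mul, mul_one]
      calc |s| ^ p / p.factorial * ∫ ω, Z ω ^ p ∂P
          ≤ |s| ^ p / p.factorial * (a * p) ^ p := by gcongr; exact hle p hp
        _ = (|s| * a) ^ p * ((p : ℝ) ^ p / p.factorial) := by rw [mul_pow, mul_pow]; ring
        _ ≤ (|s| * a) ^ p * exp 1 ^ p := by gcongr; rw [← h2]; exact h1
        _ = r ^ p := by rw [hr, mul_pow _ (exp 1)]
  have hgeo : Summable fun p : ℕ => r ^ p := summable_geometric_of_lt_one hr0 (by linarith)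
  have hFs : Summable fun p => ∫ ω, ‖F p ω‖ ∂P :=
    hgeo.of_nonneg_of_le (fun p => integral_nonneg fun ω => norm_nonneg _) hFn
  have hF : ∀ ω, HasSum (fun p => F p ω) (exp (s * Z ω)) := fun ω => by
    rw [Real.exp_eq_exp_ℝ]
    exact NormedSpace.expSeries_div_hasSum_exp (s * Z ω)
  refine ⟨integrable_of_hasSum_of_summable_integral_norm hFi hFs
    (Real.continuous_exp.comp_aestronglyMeasurable (hZm.const_mul s)) hF, ?_⟩
  have hsum := hasSum_integral_of_summable_integral_norm hFi hFs
  simp_rw [(hF _).tsum_eq] at hsum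
  -- The terms of order 0 and 1 are kept exact, so `Z` need not be centered; the others add up to at
  -- most `r ^ 2 / (1 - r) ≤ 2 * r ^ 2`.
  have h2 := (hasSum_nat_add_iff' 2).mpr hsum
  have hgeo2 : HasSum (fun p : ℕ => r ^ (p + 2)) (r ^ 2 * (1 - r)⁻¹) := by
    simp_rw [pow_add, mul_comm _ (r ^ 2)]
    exact (hasSum_geometric_of_lt_one hr0 (by linarith)).mul_left _
  have h3 := hasSum_le (fun p => (le_abs_self _).trans
    ((norm_integral_le_integral_norm (F (p + 2))).trans (hFn (p + 2)))) h2 hgeo2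
  have h0 : ∑ i ∈ Finset.range 2, ∫ ω, F i ω ∂P = 1 + s * ∫ ω, Z ω ∂P := by
    simp [Finset.sum_range_succ, F, integral_const_mul]
  rw [h0] at h3
  have h4 : r ^ 2 * (1 - r)⁻¹ ≤ 2 * r ^ 2 := by
    rw [mul_comm]
    gcongr
    rw [inv_le_comm₀ (by linarith) (by norm_num)]
    linarith
  have h5 : r ^ 2 = (s * a * exp 1) ^ 2 := by
    rw [hr, mul_assoc, mul_pow, sq_abs]
    ring
  have h6 := Real.add_one_le_exp (s * ∫ ω, Z ω ∂P + 2 * (s * a * exp 1) ^ 2)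
  rw [mgf]
  linarith

/-- A Chernoff bound for sums of independent identically distributed random variables. -/
theorem measure_sum_sub_ge_le [IsProbabilityMeasure P] {n : ℕ} {Z : Fin n → Ω → ℝ}
    {Z₀ : Ω → ℝ} (hZ : ∀ i, IdentDistrib (Z i) Z₀ P P) (hind : iIndepFun Z P) {s μ B t : ℝ}
    (hs : 0 ≤ s) (hint : Integrable (fun ω => exp (s * Z₀ ω)) P)
    (hmgf : mgf Z₀ P s ≤ exp (s * μ + B * s ^ 2)) :
    P.real {ω | n * (μ + t) ≤ ∑ i, Z i ω} ≤ exp (n * (B * s ^ 2 - s * t)) := by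
  have hm : ∀ i, AEMeasurable (Z i) P := fun i => (hZ i).aemeasurable_fst
  have h1 : mgf (∑ i, Z i) P s = mgf Z₀ P s ^ n := by
    rw [hind.mgf_sum₀ hm, Finset.prod_congr rfl fun i _ =>
      congrFun (mgf_congr_identDistrib (hZ i)) s]
    simp
  have hpos : 0 < mgf Z₀ P s := mgf_pos hint
  -- The moment generating function takes the default value 0 without integrability, so its
  -- positivity suffices.
  have hsi : Integrable (fun ω => exp (s * (∑ i, Z i) ω)) P := by
    by_contra hc
    have := mgf_undef hc
    rw [h1] at this
    exact (pow_pos hpos n).ne' this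
  have h2 := measure_ge_le_exp_mul_mgf (n * (μ + t)) hs hsi
  simp only [Finset.sum_apply] at h2
  refine h2.trans ?_
  rw [h1]
  calc exp (-s * (n * (μ + t))) * mgf Z₀ P s ^ n
      ≤ exp (-s * (n * (μ + t))) * exp (s * μ + B * s ^ 2) ^ n := by gcongr
    _ = _ := by
      rw [← Real.exp_nat_mul, ← Real.exp_add]
      congr 1
      ring

/-- A Bernstein-type inequality for sums of independent copies of a nonnegative random variable
with `E Z ^ p ≤ (a p) ^ p`. -/
theorem measure_abs_sum_sub_ge_le [IsProbabilityMeasure P] {n : ℕ} {Z : Fin n → Ω → ℝ}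
    {Z₀ : Ω → ℝ} (hZ : ∀ i, IdentDistrib (Z i) Z₀ P P) (hind : iIndepFun Z P)
    (hZ₀ : ∀ ω, 0 ≤ Z₀ ω) {a : ℝ} (ha : 1 ≤ a)
    (hint : ∀ p : ℕ, 1 ≤ p → Integrable (fun ω => Z₀ ω ^ p) P)
    (hle : ∀ p : ℕ, 1 ≤ p → ∫ ω, Z₀ ω ^ p ∂P ≤ (a * p) ^ p)
    {t : ℝ} (ht : 0 ≤ t) (ht1 : t ≤ 1) :
    P.real {ω | n * t ≤ |∑ i, Z i ω - n * ∫ ω, Z₀ ω ∂P|} ≤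
      2 * exp (-(n * t ^ 2 / (8 * (a * exp 1) ^ 2))) := by
  set μ := ∫ ω, Z₀ ω ∂P with hμ
  set c := a * exp 1 with hc
  have hc1 : 1 ≤ c := by
    have := Real.add_one_le_exp 1
    nlinarith
  have hm : AEStronglyMeasurable Z₀ P := by simpa using (hint 1 le_rfl).1
  -- This is the minimizer of `2 * c ^ 2 * s ^ 2 - s * t`; it is admissible because `t ≤ 1 ≤ c`.
  set s := t / (4 * c ^ 2) with hs
  have hs0 : 0 ≤ s := by positivity
  have hsc : s * c ≤ 1 / 2 := by
    rw [hs, div_mul_eq_mul_div, div_le_iff₀ (by positivity)]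
    nlinarith
  have hB : n * (2 * c ^ 2 * s ^ 2 - s * t) = -(n * t ^ 2 / (8 * c ^ 2)) := by
    rw [hs]
    field_simp
    ring
  have hup := mgf_le_of_integral_pow_le hm hZ₀ (by linarith) hint hle (s := s)
    (by rw [abs_of_nonneg hs0, mul_assoc]; exact hsc)
  have hlo := mgf_le_of_integral_pow_le hm hZ₀ (by linarith) hint hle (s := -s)
    (by rw [abs_neg, abs_of_nonneg hs0, mul_assoc]; exact hsc)
  have k1 := measure_sum_sub_ge_le hZ hind (μ := μ) (B := 2 * c ^ 2) (t := t) hs0 hup.1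
    (hup.2.trans (le_of_eq (by rw [hc, ← hμ]; ring_nf)))
  have k2 := measure_sum_sub_ge_le (Z := fun i => -Z i) (Z₀ := -Z₀) (μ := -μ) (B := 2 * c ^ 2)
    (t := t) (fun i => (hZ i).comp measurable_neg)
    (hind.comp (fun _ => Neg.neg) fun _ => measurable_neg) hs0
    (by simpa using hlo.1)
    (by rw [mgf_neg]; exact hlo.2.trans (le_of_eq (by rw [hc, ← hμ]; ring_nf)))
  rw [hB] at k1 k2
  have hsub : {ω | n * t ≤ |∑ i, Z i ω - n * μ|} ⊆
      {ω | n * (μ + t) ≤ ∑ i, Z i ω} ∪ {ω | n * (-μ + t) ≤ ∑ i, (fun i => -Z i) i ω} := by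
    intro ω hω
    rcases le_abs.mp hω.out with h | h
    · left
      rw [Set.mem_ofPred_eq]
      linarith
    · right
      simp only [Set.mem_ofPred_eq, Pi.neg_apply, Finset.sum_neg_distrib]
      linarith
  refine (measureReal_mono hsub).trans ((measureReal_union_le _ _).trans ?_)
  linarith

end Scalar

/-! ### Quadratic forms and norms of matrices. -/

section Matrices

theorem inner_toEuclideanLin {m d : ℕ} (M : Matrix (Fin m) (Fin d) ℝ)
    (v : EuclideanSpace ℝ (Fin d)) (w : EuclideanSpace ℝ (Fin m)) :
    inner ℝ (Matrix.toEuclideanLin M v) w = ∑ i, ∑ j, M i j * (v j * w i) := by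
  simp only [PiLp.inner_apply, Matrix.toLpLin_apply, Matrix.mulVec, dotProduct,
    RCLike.inner_apply, RCLike.conj_to_real, Finset.mul_sum]
  exact Finset.sum_congr rfl fun i _ => Finset.sum_congr rfl fun j _ => by ring

theorem inner_mul_inner_eq_sum {m : ℕ} (x v w : EuclideanSpace ℝ (Fin m)) :
    inner ℝ x v * inner ℝ x w = ∑ i, ∑ j, x i * x j * (v j * w i) := by
  simp only [PiLp.inner_apply, RCLike.inner_apply, RCLike.conj_to_real]
  rw [mul_comm, Finset.sum_mul_sum]
  exact Finset.sum_congr rfl fun i _ => Finset.sum_congr rfl fun j _ => by ring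

theorem inner_empCov {m n : ℕ} (y : Fin n → EuclideanSpace ℝ (Fin m))
    (v w : EuclideanSpace ℝ (Fin m)) :
    inner ℝ (Matrix.toEuclideanLin (empCov y) v) w =
      (n : ℝ)⁻¹ * ∑ i, inner ℝ (y i) v * inner ℝ (y i) w := by
  simp_rw [inner_toEuclideanLin, inner_mul_inner_eq_sum]
  conv_rhs => rw [Finset.sum_comm, Finset.mul_sum]
  refine Finset.sum_congr rfl fun i _ => ?_
  conv_rhs => rw [Finset.sum_comm, Finset.mul_sum]
  refine Finset.sum_congr rfl fun j _ => ?_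
  simp only [empCov, Matrix.smul_apply, Matrix.sum_apply, Matrix.vecMulVec_apply, smul_eq_mul,
    Finset.sum_mul, Finset.mul_sum, mul_assoc]

theorem isSymmetric_empCov {m n : ℕ} (y : Fin n → EuclideanSpace ℝ (Fin m)) :
    (Matrix.toEuclideanLin (empCov y)).IsSymmetric := fun v w => by
  rw [inner_empCov, real_inner_comm, inner_empCov]
  simp_rw [mul_comm]

theorem norm_toEuclideanLin_le {m d : ℕ} (A : Matrix (Fin m) (Fin d) ℝ)
    (x : EuclideanSpace ℝ (Fin d)) : ‖Matrix.toEuclideanLin A x‖ ≤ ‖A‖ * ‖x‖ :=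
  A.l2_opNorm_mulVec x

theorem norm_adjoint_toEuclideanLin_le {m d : ℕ} (A : Matrix (Fin m) (Fin d) ℝ)
    (v : EuclideanSpace ℝ (Fin m)) :
    ‖LinearMap.adjoint (Matrix.toEuclideanLin A) v‖ ≤ ‖A‖ * ‖v‖ := by
  set u := LinearMap.adjoint (Matrix.toEuclideanLin A) v with hu
  have h1 : ‖u‖ ^ 2 = inner ℝ (Matrix.toEuclideanLin A u) v := by
    rw [← LinearMap.adjoint_inner_right, ← hu, real_inner_self_eq_norm_sq]
  have h2 := real_inner_le_norm (Matrix.toEuclideanLin A u) v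
  have h3 := mul_le_mul_of_nonneg_right (norm_toEuclideanLin_le A u) (norm_nonneg v)
  rcases (norm_nonneg u).eq_or_lt with h0 | h0
  · rw [← h0]; positivity
  · exact le_of_mul_le_mul_right (by nlinarith) h0

end Matrices

/-! ### Covariance operators and their rank under a linear map. -/

section Covariance

variable {Ω : Type*} [MeasurableSpace Ω] {P : Measure Ω}

theorem inner_cov {k : ℕ} {ξ : Ω → EuclideanSpace ℝ (Fin k)}
    (hξ : ∀ v, MemLp (fun ω => inner ℝ (ξ ω) v) 2 P) (v w : EuclideanSpace ℝ (Fin k)) :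
    inner ℝ (Matrix.toEuclideanLin (cov P ξ) v) w = ∫ ω, inner ℝ (ξ ω) v * inner ℝ (ξ ω) w ∂P := by
  have hc : ∀ i, MemLp (fun ω => ξ ω i) 2 P := fun i => by
    simpa [EuclideanSpace.inner_single_right] using hξ (EuclideanSpace.single i 1)
  have hi : ∀ i j, Integrable (fun ω => ξ ω i * ξ ω j) P := fun i j => (hc i).integrable_mul (hc j)
  rw [inner_toEuclideanLin]
  simp_rw [inner_mul_inner_eq_sum]
  rw [integral_finsetSum _ fun i _ => integrable_finsetSum _ fun j _ => (hi i j).mul_const _]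
  refine Finset.sum_congr rfl fun i _ => ?_
  rw [integral_finsetSum _ fun j _ => (hi i j).mul_const _]
  refine Finset.sum_congr rfl fun j _ => ?_
  rw [integral_mul_const]
  rfl

theorem isSymmetric_cov {k : ℕ} (ξ : Ω → EuclideanSpace ℝ (Fin k)) :
    (Matrix.toEuclideanLin (cov P ξ)).IsSymmetric := by
  refine Matrix.isSymmetric_toEuclideanLin_iff.mpr ?_
  ext i j
  simp [cov, mul_comm]

theorem toEuclideanLin_cov_applyMat {m d : ℕ} (A : Matrix (Fin m) (Fin d) ℝ)
    {X : Ω → EuclideanSpace ℝ (Fin d)} (hX : ∀ v, MemLp (fun ω => inner ℝ (X ω) v) 2 P) :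
    Matrix.toEuclideanLin (cov P (applyMat A X)) = Matrix.toEuclideanLin A ∘ₗ
      Matrix.toEuclideanLin (cov P X) ∘ₗ LinearMap.adjoint (Matrix.toEuclideanLin A) := by
  have e : ∀ ω v, inner ℝ (applyMat A X ω) v =
      inner ℝ (X ω) (LinearMap.adjoint (Matrix.toEuclideanLin A) v) := fun ω v =>
    (LinearMap.adjoint_inner_right _ _ _).symm
  refine LinearMap.ext fun v => ext_inner_right ℝ fun w => ?_
  rw [inner_cov (fun v => by simp_rw [e]; exact hX _)]
  simp_rw [e]
  rw [← inner_cov hX, LinearMap.adjoint_inner_right]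
  rfl

/-- In `A Σ_X A*` the right factor is surjective and the left one injective, so neither changes the
rank. -/
theorem finrank_range_cov_applyMat {m d : ℕ} {A : Matrix (Fin m) (Fin d) ℝ}
    (hA : Function.Injective (Matrix.toEuclideanLin A))
    {X : Ω → EuclideanSpace ℝ (Fin d)} (hX : ∀ v, MemLp (fun ω => inner ℝ (X ω) v) 2 P) :
    Module.finrank ℝ (LinearMap.range (Matrix.toEuclideanLin (cov P (applyMat A X)))) =
      (cov P X).rank := by
  have hs : LinearMap.range (LinearMap.adjoint (Matrix.toEuclideanLin A)) = ⊤ := by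
    rw [← Submodule.orthogonal_eq_bot_iff, LinearMap.orthogonal_range, LinearMap.adjoint_adjoint]
    exact LinearMap.ker_eq_bot.mpr hA
  rw [toEuclideanLin_cov_applyMat A hX, LinearMap.range_comp,
    LinearMap.range_comp_of_range_eq_top _ hs, ← (Submodule.equivMapOfInjective _ hA _).finrank_eq,
    Matrix.rank_eq_finrank_range_toLin _ (PiLp.basisFun 2 ℝ (Fin d)) (PiLp.basisFun 2 ℝ (Fin d))]
  rfl

end Covariance

/-! ### Sub-gaussian vectors and concentration of the empirical covariance. -/

section SubGaussian

variable {Ω : Type*} [MeasurableSpace Ω] {P : Measure Ω} {k : ℕ}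

theorem eLpNorm_inner_le_of_psi2Norm_le {ξ : Ω → EuclideanSpace ℝ (Fin k)} {κ : ℝ}
    (hκ : 0 ≤ κ) (h : psi2Norm P ξ ≤ ENNReal.ofReal κ) (v : EuclideanSpace ℝ (Fin k)) {q : ℝ}
    (hq : 1 ≤ q) :
    eLpNorm (fun ω => inner ℝ (ξ ω) v) (ENNReal.ofReal q) P ≤ ENNReal.ofReal (κ * ‖v‖ * √q) := by
  have hq0 : 0 < q := by linarith
  have hunit : ∀ u : EuclideanSpace ℝ (Fin k), ‖u‖ = 1 →
      eLpNorm (fun ω => inner ℝ (ξ ω) u) (ENNReal.ofReal q) P ≤ ENNReal.ofReal (κ * √q) := by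
    intro u hu
    have h1 : ENNReal.ofReal (q ^ (-(1 / 2) : ℝ)) *
        eLpNorm (fun ω => inner ℝ (ξ ω) u) (ENNReal.ofReal q) P ≤ ENNReal.ofReal κ := by
      refine le_trans ?_ h
      refine le_iSup₂_of_le u (by simpa using hu) ?_
      exact le_iSup₂_of_le (f := fun (q : ℝ) (_ : q ∈ Set.Ici (1 : ℝ)) =>
        ENNReal.ofReal (q ^ (-(1 / 2) : ℝ)) *
          eLpNorm (fun ω => inner ℝ (ξ ω) u) (ENNReal.ofReal q) P) q hq le_rfl
    have h2 : ENNReal.ofReal (√q) * ENNReal.ofReal (q ^ (-(1 / 2) : ℝ)) = 1 := by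
      rw [← ENNReal.ofReal_mul (by positivity), Real.sqrt_eq_rpow, ← Real.rpow_add hq0]
      norm_num
    calc eLpNorm (fun ω => inner ℝ (ξ ω) u) (ENNReal.ofReal q) P
        = ENNReal.ofReal (√q) * (ENNReal.ofReal (q ^ (-(1 / 2) : ℝ)) *
            eLpNorm (fun ω => inner ℝ (ξ ω) u) (ENNReal.ofReal q) P) := by
          rw [← mul_assoc, h2, one_mul]
      _ ≤ ENNReal.ofReal (√q) * ENNReal.ofReal κ := by gcongr
      _ = ENNReal.ofReal (κ * √q) := by rw [mul_comm, ENNReal.ofReal_mul hκ]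
  rcases eq_or_ne v 0 with rfl | hv
  · simp
  have hv' : 0 < ‖v‖ := norm_pos_iff.mpr hv
  have e : (fun ω => inner ℝ (ξ ω) v) = ‖v‖ • fun ω => inner ℝ (ξ ω) (‖v‖⁻¹ • v) := by
    funext ω
    simp only [Pi.smul_apply, inner_smul_right, smul_eq_mul]
    field_simp
  rw [e, eLpNorm_const_smul]
  have h3 := hunit (‖v‖⁻¹ • v) (by simp [norm_smul, hv'.ne'])
  rw [enorm_norm, ← ofReal_norm]
  calc _ ≤ ENNReal.ofReal ‖v‖ * ENNReal.ofReal (κ * √q) := by gcongr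
    _ = _ := by rw [← ENNReal.ofReal_mul hv'.le]; congr 1; ring

theorem memLp_inner_of_psi2Norm_le {ξ : Ω → EuclideanSpace ℝ (Fin k)} (hξ : Measurable ξ) {κ : ℝ}
    (hκ : 0 ≤ κ) (h : psi2Norm P ξ ≤ ENNReal.ofReal κ) (v : EuclideanSpace ℝ (Fin k)) :
    MemLp (fun ω => inner ℝ (ξ ω) v) 2 P := by
  refine ⟨(by fun_prop : Measurable fun ω => inner ℝ (ξ ω) v).aestronglyMeasurable, ?_⟩
  have := eLpNorm_inner_le_of_psi2Norm_le hκ h v (q := 2) (by norm_num)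
  rw [ENNReal.ofReal_ofNat] at this
  exact this.trans_lt ENNReal.ofReal_lt_top

/-- This is the moment bound at `q = 2`. For the noise, `κ = 1 / √2` turns the constant into exactly
1. -/
theorem integral_inner_sq_le {ξ : Ω → EuclideanSpace ℝ (Fin k)} (hξ : Measurable ξ) {κ : ℝ}
    (hκ : 0 ≤ κ) (h : psi2Norm P ξ ≤ ENNReal.ofReal κ) (v : EuclideanSpace ℝ (Fin k)) :
    ∫ ω, inner ℝ (ξ ω) v ^ 2 ∂P ≤ 2 * κ ^ 2 * ‖v‖ ^ 2 := by
  have := (integral_sq_pow_le (p := 1)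
    (by fun_prop : Measurable fun ω => inner ℝ (ξ ω) v).aestronglyMeasurable
    (by positivity : 0 ≤ κ * ‖v‖)
    (fun q hq => eLpNorm_inner_le_of_psi2Norm_le hκ h v hq) le_rfl).2
  simp only [pow_one, Nat.cast_one, mul_one] at this
  linarith [mul_pow κ ‖v‖ 2]

theorem integrable_of_memLp_inner [IsFiniteMeasure P] {ξ : Ω → EuclideanSpace ℝ (Fin k)}
    (h : ∀ v, MemLp (fun ω => inner ℝ (ξ ω) v) 2 P) : Integrable ξ P := by
  have e : ξ = fun ω => ∑ i, inner ℝ (ξ ω) (EuclideanSpace.basisFun (Fin k) ℝ i) •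
      EuclideanSpace.basisFun (Fin k) ℝ i := by
    funext ω
    conv_lhs => rw [← (EuclideanSpace.basisFun (Fin k) ℝ).sum_repr' (ξ ω)]
    simp_rw [real_inner_comm]
  rw [e]
  exact integrable_finsetSum _ fun i _ =>
    ((h _).integrable (by norm_num)).smul_const _

/-- Concentration of the empirical covariance matrix of independent copies of a sub-gaussian
random vector. -/
theorem exists_event_norm_empCov_sub_cov_le [IsProbabilityMeasure P] {n : ℕ}
    {Y : Ω → EuclideanSpace ℝ (Fin k)} {Ys : Fin n → Ω → EuclideanSpace ℝ (Fin k)}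
    (hY : Measurable Y) {K : ℝ} (hK : 1 ≤ K)
    (hpsi : ∀ v : EuclideanSpace ℝ (Fin k), ‖v‖ = 1 → ∀ q : ℝ, 1 ≤ q →
      eLpNorm (fun ω => inner ℝ (Y ω) v) (ENNReal.ofReal q) P ≤ ENNReal.ofReal (K * √q))
    (hL2 : ∀ v, MemLp (fun ω => inner ℝ (Y ω) v) 2 P)
    (hYs : ∀ i, IdentDistrib (Ys i) Y P P) (hind : iIndepFun Ys P) (hn : 0 < n)
    {τ : ℝ} (hτ : 0 < τ) {t : ℝ} (ht : t = 8 * K ^ 2 * Real.exp 1 * ((√(k : ℝ) + τ) / √(n : ℝ)))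
    (ht1 : t ≤ 1) :
    ∃ E : Set Ω, MeasurableSet E ∧ 1 - 2 * Real.exp (-τ ^ 2) < P.real E ∧ ∀ ω ∈ E, ∀ x,
      ‖(Matrix.toEuclideanLin (empCov fun i => Ys i ω) - Matrix.toEuclideanLin (cov P Y)) x‖ ≤
        32 * t * ‖x‖ := by
  obtain ⟨N, hcard, hN1, hN⟩ := exists_half_net_sphere (E := EuclideanSpace ℝ (Fin k))
  rw [finrank_euclideanSpace_fin] at hcard
  have hn' : (0 : ℝ) < n := by exact_mod_cast hn
  have ht0 : 0 ≤ t := by rw [ht]; positivity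
  let bad : EuclideanSpace ℝ (Fin k) → Set Ω := fun v =>
    {ω | n * t ≤ |∑ i, inner ℝ (Ys i ω) v ^ 2 - n * ∫ ω, inner ℝ (Y ω) v ^ 2 ∂P|}
  have hbad : ∀ v ∈ N, P.real (bad v) ≤ 2 * Real.exp (-2 * k - 2 * τ ^ 2) := by
    intro v hv
    have hφ : Measurable fun y : EuclideanSpace ℝ (Fin k) => inner ℝ y v ^ 2 := by fun_prop
    have hmom := fun (p : ℕ) (hp : 1 ≤ p) => integral_sq_pow_le
      (by fun_prop : Measurable fun ω => inner ℝ (Y ω) v).aestronglyMeasurable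
      (by linarith) (hpsi v (hN1 v hv)) hp
    have := measure_abs_sum_sub_ge_le (Z := fun i ω => inner ℝ (Ys i ω) v ^ 2)
      (Z₀ := fun ω => inner ℝ (Y ω) v ^ 2) (fun i => (hYs i).comp hφ)
      (hind.comp (fun _ y => inner ℝ y v ^ 2) fun _ => hφ) (fun ω => sq_nonneg _)
      (a := 2 * K ^ 2) (by nlinarith) (fun p hp => (hmom p hp).1) (fun p hp => (hmom p hp).2)
      ht0 ht1
    refine this.trans ?_
    gcongr
    -- The factor 8 in `t` is chosen to make the exponent `2 (√k + τ)² ≥ 2 k + 2 τ²`.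
    have e : n * t ^ 2 / (8 * (2 * K ^ 2 * Real.exp 1) ^ 2) = 2 * (√(k : ℝ) + τ) ^ 2 := by
      rw [ht, mul_pow, div_pow, Real.sq_sqrt hn'.le]
      field_simp
      norm_num
    rw [e]
    have h1 := Real.sq_sqrt (Nat.cast_nonneg (α := ℝ) k)
    have h2 := mul_nonneg (Real.sqrt_nonneg (k : ℝ)) hτ.le
    nlinarith
  set B : Set Ω := ⋃ v ∈ N, bad v with hB
  have hPB : P.real B < 2 * Real.exp (-τ ^ 2) := by
    have h1 : P.real B ≤ ∑ v ∈ N, P.real (bad v) := measureReal_biUnion_finset_le _ _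
    have h2 : ∑ v ∈ N, P.real (bad v) ≤ N.card * (2 * Real.exp (-2 * k - 2 * τ ^ 2)) := by
      rw [← nsmul_eq_mul]
      exact Finset.sum_le_card_nsmul _ _ _ hbad
    have h3 : (N.card : ℝ) ≤ 5 ^ k := by exact_mod_cast hcard
    -- Since `5 < e ^ 2`, the part `2 k` of the exponent pays for the size of the net.
    have h4 : (5 : ℝ) ^ k ≤ Real.exp (2 * k) := by
      rw [mul_comm, Real.exp_nat_mul]
      gcongr
      have := Real.exp_one_gt_d9
      rw [show (2 : ℝ) = 1 + 1 by norm_num, Real.exp_add]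
      nlinarith
    calc P.real B ≤ Real.exp (2 * k) * (2 * Real.exp (-2 * k - 2 * τ ^ 2)) :=
          h1.trans (h2.trans (by gcongr; exact h3.trans h4))
      _ = 2 * Real.exp (-2 * τ ^ 2) := by
          rw [mul_left_comm, ← Real.exp_add]
          ring_nf
      _ < 2 * Real.exp (-τ ^ 2) := by
          gcongr
          nlinarith [sq_pos_of_pos hτ]
  -- The copies are only known to be a.e. measurable, so `B` is replaced by a measurable superset of
  -- the same measure.
  refine ⟨(toMeasurable P B)ᶜ, (measurableSet_toMeasurable P B).compl, ?_, fun ω hω => ?_⟩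
  · rw [probReal_compl_eq_one_sub (measurableSet_toMeasurable P B), Measure.real,
      measure_toMeasurable]
    change _ < 1 - P.real B
    linarith
  · have hωB : ω ∉ B := fun h => hω (subset_toMeasurable P B h)
    refine norm_apply_le_of_net ((isSymmetric_empCov _).sub (isSymmetric_cov Y)) (N := N)
      hN hN1 fun v hv => ?_
    have hv' : ω ∉ bad v := fun h => hωB (Set.mem_biUnion hv h)
    have h1 : |∑ i, inner ℝ (Ys i ω) v ^ 2 - n * ∫ ω, inner ℝ (Y ω) v ^ 2 ∂P| < n * t :=
      not_le.mp hv'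
    rw [LinearMap.sub_apply, inner_sub_left, inner_empCov, inner_cov hL2]
    simp_rw [← sq]
    have e : (n : ℝ)⁻¹ * ∑ i, inner ℝ (Ys i ω) v ^ 2 - ∫ ω, inner ℝ (Y ω) v ^ 2 ∂P =
        (n : ℝ)⁻¹ * (∑ i, inner ℝ (Ys i ω) v ^ 2 - n * ∫ ω, inner ℝ (Y ω) v ^ 2 ∂P) := by
      field_simp
    rw [e, abs_mul, abs_of_pos (inv_pos.mpr hn'), inv_mul_le_iff₀ hn']
    exact h1.le

end SubGaussian

/-! ### The inverse problem: sub-gaussian data, bias of the covariance, sample size. -/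

section Model

variable {Ω : Type*} {m d : ℕ} {A : Matrix (Fin m) (Fin d) ℝ}
  {X : Ω → EuclideanSpace ℝ (Fin d)} {W : Ω → EuclideanSpace ℝ (Fin m)} {σ : ℝ} {h : ℕ}

theorem inner_datum (ω : Ω) (v : EuclideanSpace ℝ (Fin m)) :
    inner ℝ (datum A σ X W ω) v =
      inner ℝ (X ω) (LinearMap.adjoint (Matrix.toEuclideanLin A) v) + σ * inner ℝ (W ω) v := by
  rw [datum, inner_add_left, LinearMap.adjoint_inner_right, inner_smul_left]
  rfl

variable [MeasurableSpace Ω] {P : Measure Ω}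

theorem measurable_datum_map (A : Matrix (Fin m) (Fin d) ℝ) (σ : ℝ) :
    Measurable fun p : EuclideanSpace ℝ (Fin d) × EuclideanSpace ℝ (Fin m) =>
      Matrix.toEuclideanLin A p.1 + σ • p.2 := by
  have : Measurable (Matrix.toEuclideanLin A) :=
    (LinearMap.continuous_of_finiteDimensional _).measurable
  fun_prop

namespace IsInverseProblem

theorem measurable_datum (H : IsInverseProblem P A X W σ h) : Measurable (datum A σ X W) := by
  have hA : Measurable (Matrix.toEuclideanLin A) :=
    (LinearMap.continuous_of_finiteDimensional _).measurable
  exact (hA.comp H.measurable_X).add (H.measurable_W.const_smul σ)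

theorem memLp_inner_X (H : IsInverseProblem P A X W σ h) (v : EuclideanSpace ℝ (Fin d)) :
    MemLp (fun ω => inner ℝ (X ω) v) 2 P :=
  memLp_inner_of_psi2Norm_le H.measurable_X zero_le_one (by simp [H.psi2_X]) v

theorem memLp_inner_W (H : IsInverseProblem P A X W σ h) (v : EuclideanSpace ℝ (Fin m)) :
    MemLp (fun ω => inner ℝ (W ω) v) 2 P :=
  memLp_inner_of_psi2Norm_le H.measurable_W (by positivity) H.psi2_W.le v

theorem memLp_inner_datum (H : IsInverseProblem P A X W σ h) (v : EuclideanSpace ℝ (Fin m)) :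
    MemLp (fun ω => inner ℝ (datum A σ X W ω) v) 2 P := by
  simp_rw [inner_datum]
  exact (H.memLp_inner_X _).add ((H.memLp_inner_W v).const_mul σ)

/-- Signal and noise contribute at most `√q` each, because `‖A* v‖ ≤ 1` and `σ / √2 ≤ 1`. -/
theorem eLpNorm_inner_datum_le (H : IsInverseProblem P A X W σ h)
    {v : EuclideanSpace ℝ (Fin m)} (hv : ‖v‖ = 1) {q : ℝ} (hq : 1 ≤ q) :
    eLpNorm (fun ω => inner ℝ (datum A σ X W ω) v) (ENNReal.ofReal q) P ≤
      ENNReal.ofReal (2 * √q) := by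
  simp_rw [inner_datum]
  have hX := eLpNorm_inner_le_of_psi2Norm_le zero_le_one (by simp [H.psi2_X])
    (LinearMap.adjoint (Matrix.toEuclideanLin A) v) (P := P) (ξ := X) hq
  have hW := eLpNorm_inner_le_of_psi2Norm_le (by positivity) H.psi2_W.le v hq
  have hA := norm_adjoint_toEuclideanLin_le A v
  rw [H.norm_A, hv, one_mul] at hA
  have h1 : (1 : ℝ≥0∞) ≤ ENNReal.ofReal q := ENNReal.one_le_ofReal.mpr hq
  refine (eLpNorm_add_le (H.memLp_inner_X _).1 ((H.memLp_inner_W v).const_mul σ).1 h1).trans ?_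
  have h2 : eLpNorm (fun ω => σ * inner ℝ (W ω) v) (ENNReal.ofReal q) P ≤
      ENNReal.ofReal (√q) := by
    rw [show (fun ω => σ * inner ℝ (W ω) v) = σ • fun ω => inner ℝ (W ω) v from rfl,
      eLpNorm_const_smul, Real.enorm_eq_ofReal H.sigma_pos.le]
    refine (mul_le_mul_right hW _).trans ?_
    rw [← ENNReal.ofReal_mul H.sigma_pos.le, hv]
    refine ENNReal.ofReal_le_ofReal ?_
    have h3 : σ * (1 / √2) ≤ 1 := by
      rw [mul_one_div, div_le_one (by positivity)]
      exact H.sigma_lt.le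
    nlinarith [Real.sqrt_nonneg q]
  have h3 : ENNReal.ofReal (2 * √q) = ENNReal.ofReal (√q) + ENNReal.ofReal (√q) := by
    rw [two_mul, ENNReal.ofReal_add (by positivity) (by positivity)]
  rw [h3]
  refine add_le_add (hX.trans (ENNReal.ofReal_le_ofReal ?_)) h2
  nlinarith [Real.sqrt_nonneg q]

/-- The cross term factorizes by independence and vanishes because `W` is centered; `X` need not be.
-/
theorem inner_cov_datum [IsProbabilityMeasure P] (H : IsInverseProblem P A X W σ h)
    (v : EuclideanSpace ℝ (Fin m)) :
    inner ℝ (Matrix.toEuclideanLin (cov P (datum A σ X W)) v) v =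
      inner ℝ (Matrix.toEuclideanLin (cov P (applyMat A X)) v) v +
        σ ^ 2 * ∫ ω, inner ℝ (W ω) v ^ 2 ∂P := by
  set u := LinearMap.adjoint (Matrix.toEuclideanLin A) v with hu
  have hX := H.memLp_inner_X u
  have hW := H.memLp_inner_W v
  have hAX : inner ℝ (Matrix.toEuclideanLin (cov P (applyMat A X)) v) v =
      ∫ ω, inner ℝ (X ω) u ^ 2 ∂P := by
    rw [toEuclideanLin_cov_applyMat A H.memLp_inner_X]
    change inner ℝ (Matrix.toEuclideanLin A _) v = _
    rw [← LinearMap.adjoint_inner_right]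
    simp_rw [sq]
    exact inner_cov H.memLp_inner_X u u
  have hW0 : ∫ ω, inner ℝ (W ω) v ∂P = 0 := by
    have := integral_inner (𝕜 := ℝ) (integrable_of_memLp_inner H.memLp_inner_W) v
    rw [H.centered_W, inner_zero_right] at this
    simpa only [real_inner_comm v] using this
  have hind : IndepFun (fun ω => inner ℝ (X ω) u) (fun ω => inner ℝ (W ω) v) P :=
    H.indep.comp (φ := fun x => inner ℝ x u) (ψ := fun w => inner ℝ w v)
      (by fun_prop) (by fun_prop)
  have hcross : ∫ ω, inner ℝ (X ω) u * inner ℝ (W ω) v ∂P = 0 := by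
    rw [hind.integral_fun_mul_eq_mul_integral hX.1 hW.1, hW0, mul_zero]
  have hXW : Integrable (fun ω => inner ℝ (X ω) u * inner ℝ (W ω) v) P := hX.integrable_mul hW
  rw [inner_cov H.memLp_inner_datum, hAX]
  have e : ∀ ω, inner ℝ (datum A σ X W ω) v * inner ℝ (datum A σ X W ω) v =
      inner ℝ (X ω) u ^ 2 + 2 * σ * (inner ℝ (X ω) u * inner ℝ (W ω) v) +
        σ ^ 2 * inner ℝ (W ω) v ^ 2 := fun ω => by
    rw [inner_datum]
    ring
  simp_rw [e]
  rw [integral_add (f := fun ω => inner ℝ (X ω) u ^ 2 +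
      2 * σ * (inner ℝ (X ω) u * inner ℝ (W ω) v)) (hX.integrable_sq.add (hXW.const_mul _))
      (hW.integrable_sq.const_mul _),
    integral_add hX.integrable_sq (hXW.const_mul _), integral_const_mul, integral_const_mul, hcross]
  ring

theorem norm_cov_datum_sub_le [IsProbabilityMeasure P] (H : IsInverseProblem P A X W σ h)
    (x : EuclideanSpace ℝ (Fin m)) :
    ‖(Matrix.toEuclideanLin (cov P (datum A σ X W)) -
      Matrix.toEuclideanLin (cov P (applyMat A X))) x‖ ≤ σ ^ 2 * ‖x‖ := by
  refine norm_apply_le_of_abs_inner_le ((isSymmetric_cov _).sub (isSymmetric_cov _))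
    (fun v => ?_) x
  rw [LinearMap.sub_apply, inner_sub_left, H.inner_cov_datum, add_sub_cancel_left, abs_mul,
    abs_of_nonneg (sq_nonneg σ), abs_of_nonneg (integral_nonneg fun ω => sq_nonneg _)]
  have := integral_inner_sq_le H.measurable_W (by positivity) H.psi2_W.le v
  rw [div_pow, Real.sq_sqrt (by norm_num)] at this
  gcongr
  linarith

theorem inner_cov_applyMat_nonneg (H : IsInverseProblem P A X W σ h)
    (v : EuclideanSpace ℝ (Fin m)) :
    0 ≤ inner ℝ (Matrix.toEuclideanLin (cov P (applyMat A X)) v) v := by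
  rw [toEuclideanLin_cov_applyMat A H.memLp_inner_X]
  change 0 ≤ inner ℝ (Matrix.toEuclideanLin A _) v
  rw [← LinearMap.adjoint_inner_right]
  refine (integral_nonneg fun ω => mul_self_nonneg _).trans_eq
    (inner_cov H.memLp_inner_X (LinearMap.adjoint (Matrix.toEuclideanLin A) v) _).symm

end IsInverseProblem

/-- Ensures `lam > 0`, as `lam` is specified only as the least nonzero eigenvalue. -/
theorem pos_of_hasEigenvalue_of_inner_nonneg {E : Type*} [NormedAddCommGroup E]
    [InnerProductSpace ℝ E] {T : E →ₗ[ℝ] E} (hT : ∀ x, 0 ≤ inner ℝ (T x) x) {μ : ℝ} (hμ : μ ≠ 0)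
    (h : Module.End.HasEigenvalue T μ) : 0 < μ := by
  obtain ⟨v, hv⟩ := h.exists_hasEigenvector
  have h1 := hT v
  rw [hv.apply_eq_smul, inner_smul_left, real_inner_self_eq_norm_sq] at h1
  have h2 : 0 < ‖v‖ ^ 2 := by
    have := norm_pos_iff.mpr hv.2
    positivity
  exact lt_of_le_of_ne (nonneg_of_mul_nonneg_left h1 h2) hμ.symm

/-- The sample size condition makes the deviation `κ (√m + τ) / √n` smaller than both `1` and
`lam / 256`. -/
theorem deviation_le {κ a lam n : ℝ} (hκ : 0 < κ) (ha : 0 < a) (hlam : 0 < lam) (hn : 0 < n)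
    (h : (32 * κ) ^ 2 * (a ^ 2 * max (64 / lam ^ 2) 1) ≤ n) :
    κ * (a / √n) ≤ 1 ∧ 32 * (κ * (a / √n)) ≤ lam / 8 := by
  have hsn : 0 < √n := Real.sqrt_pos.mpr hn
  have key : ∀ c : ℝ, 0 ≤ c → c ^ 2 ≤ max (64 / lam ^ 2) 1 → 32 * κ * a * c ≤ √n := by
    intro c hc hcm
    refine Real.le_sqrt_of_sq_le (le_trans ?_ h)
    calc (32 * κ * a * c) ^ 2 = (32 * κ) ^ 2 * (a ^ 2 * c ^ 2) := by ring
      _ ≤ _ := by gcongr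
  -- The values `1` and `8 / lam` of `c` are the square roots of the two entries of the maximum.
  have k1 := key 1 zero_le_one (by simp)
  have k2 := key (8 / lam) (by positivity) (by
    rw [div_pow]
    exact le_trans (by norm_num) (le_max_left _ _))
  constructor
  · rw [← mul_div_assoc, div_le_one hsn]
    nlinarith [mul_pos hκ ha]
  · rw [← mul_div_assoc, ← mul_div_assoc, div_le_iff₀ hsn]
    rw [← mul_div_assoc, div_le_iff₀ hlam] at k2
    linarith

end Model

end InvProblem

/-! ### Assembly of concentration, bias and perturbation bounds. -/

theorem theorem3p2 :
    ∃ C₁ C₂ : ℝ, 0 < C₁ ∧ 0 < C₂ ∧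
      ∀ {Ω : Type*} [MeasurableSpace Ω] (P : Measure Ω) [IsProbabilityMeasure P]
        (m d h n : ℕ) (A : Matrix (Fin m) (Fin d) ℝ)
        (X : Ω → EuclideanSpace ℝ (Fin d)) (W : Ω → EuclideanSpace ℝ (Fin m)) (σ : ℝ)
        (_ : InvProblem.IsInverseProblem P A X W σ h)
        (Xs : Fin n → Ω → EuclideanSpace ℝ (Fin d)) (Ws : Fin n → Ω → EuclideanSpace ℝ (Fin m))
        (_ : ∀ i, IdentDistrib (fun ω => (Xs i ω, Ws i ω)) (fun ω => (X ω, W ω)) P P)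
        (_ : iIndepFun (fun i => InvProblem.datum A σ (Xs i) (Ws i)) P)
        (lam : ℝ)
        (_ : IsLeast {μ : ℝ | μ ≠ 0 ∧ Module.End.HasEigenvalue
          (Matrix.toEuclideanLin (InvProblem.cov P (InvProblem.applyMat A X))) μ} lam)
        (τ : ℝ) (_ : 0 < τ)
        (_ : C₁ * ((√(m : ℝ) + τ) ^ 2 * max (64 / lam ^ 2) 1) ≤ (n : ℝ))
        (_ : σ ^ 2 < lam / 8),
        ∃ E : Set Ω, MeasurableSet E ∧ 1 - 2 * Real.exp (-τ ^ 2) < P.real E ∧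
          ∀ ω ∈ E, ∀ (b : OrthonormalBasis (Fin m) ℝ (EuclideanSpace ℝ (Fin m))) (β : Fin m → ℝ),
            InvProblem.IsOrderedEigenbasis
              (InvProblem.empCov fun i => InvProblem.datum A σ (Xs i) (Ws i) ω) b β →
            (∀ i : Fin m, (i : ℕ) < h → lam / 2 < β i) ∧
            (∀ i : Fin m, h ≤ (i : ℕ) → β i < lam / 2) ∧
            InvProblem.firstProj b h = InvProblem.upperProj
              (InvProblem.empCov fun i => InvProblem.datum A σ (Xs i) (Ws i) ω) (lam / 2) ∧
            ‖InvProblem.firstProj b h -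
                InvProblem.rangeProj (InvProblem.cov P (InvProblem.applyMat A X))‖ ≤
              C₂ * (1 / lam * (√((m : ℝ) / n) + τ / √(n : ℝ) + σ ^ 2)) := by
  have hκ : 0 < 8 * 2 ^ 2 * Real.exp 1 := by positivity
  -- With `K = 2` the deviation is `t = κ (√m + τ) / √n`, where `κ = 8 K² e`. The 32 is the loss of
  -- the net argument, and `128 = 4 * 32` includes the 4 of the projection bound.
  refine ⟨(32 * (8 * 2 ^ 2 * Real.exp 1)) ^ 2, 128 * (8 * 2 ^ 2 * Real.exp 1), by positivity,
    by positivity, ?_⟩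
  intro Ω _ P _ m d h n A X W σ H Xs Ws hid hind lam hlam τ hτ hn hσ
  set κ := 8 * 2 ^ 2 * Real.exp 1 with hκdef
  have hlam0 : 0 < lam := InvProblem.pos_of_hasEigenvalue_of_inner_nonneg
    H.inner_cov_applyMat_nonneg hlam.1.1 hlam.1.2
  have ha : 0 < √(m : ℝ) + τ := by positivity
  have hn0 : (0 : ℝ) < n := lt_of_lt_of_le (by positivity) hn
  obtain ⟨ht1, ht8⟩ := InvProblem.deviation_le hκ ha hlam0 hn0 hn
  obtain ⟨E, hE, hPE, hEω⟩ := InvProblem.exists_event_norm_empCov_sub_cov_le (P := P)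
    (Ys := fun i => InvProblem.datum A σ (Xs i) (Ws i))
    H.measurable_datum one_le_two (fun v hv q hq => H.eLpNorm_inner_datum_le hv hq)
    H.memLp_inner_datum
    (fun i => (hid i).comp (InvProblem.measurable_datum_map A σ)) hind
    (by exact_mod_cast hn0) hτ rfl ht1
  refine ⟨E, hE, hPE, fun ω hω b β hb => ?_⟩
  rw [← hκdef] at hEω
  set t := κ * ((√(m : ℝ) + τ) / √(n : ℝ)) with ht
  -- Fluctuation `32 * t ≤ lam / 8` and bias `σ ^ 2 < lam / 8` together stay below `lam / 4`.
  have G : InvProblem.IsGapPerturbation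
      (Matrix.toEuclideanLin (InvProblem.cov P (InvProblem.applyMat A X)))
      (Matrix.toEuclideanLin
        (InvProblem.empCov fun i => InvProblem.datum A σ (Xs i) (Ws i) ω)) h lam
      (32 * t + σ ^ 2) b β :=
    { symm := InvProblem.isSymmetric_cov _
      symm' := InvProblem.isSymmetric_empCov _
      nonneg := H.inner_cov_applyMat_nonneg
      lam_le := fun μ h0 hμ => hlam.2 ⟨h0, hμ⟩
      lam_pos := hlam0
      eps_nonneg := by positivity
      eps_lt := by linarith
      finrank_range :=
        (InvProblem.finrank_range_cov_applyMat H.injective_A H.memLp_inner_X).trans H.rank_cov_X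
      norm_sub_le := fun x => by
        have h1 := hEω ω hω x
        have h2 := H.norm_cov_datum_sub_le x
        rw [LinearMap.sub_apply] at h1 h2
        have h3 := norm_sub_le_norm_sub_add_norm_sub (Matrix.toEuclideanLin
          (InvProblem.empCov fun i => InvProblem.datum A σ (Xs i) (Ws i) ω) x)
          (Matrix.toEuclideanLin (InvProblem.cov P (InvProblem.datum A σ X W)) x)
          (Matrix.toEuclideanLin (InvProblem.cov P (InvProblem.applyMat A X)) x)
        linarith
      antitone := hb.antitone
      eigen := hb.eigen }
  refine ⟨fun i hi => G.lt_eigenvalue hi, fun i hi => G.eigenvalue_lt hi, ?_, ?_⟩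
  · simp only [InvProblem.firstProj, InvProblem.upperProj]
    congr 1
    exact G.span_first_eq
  · refine G.norm_starProjection_sub_le.trans ?_
    -- Allows the common constant `C₂` to cover the bias term, whose own coefficient is only 4.
    have hκ1 : 1 ≤ 32 * κ := by
      have := Real.add_one_le_exp 1
      linarith
    have e : 128 * κ * (1 / lam * (√((m : ℝ) / n) + τ / √(n : ℝ) + σ ^ 2)) =
        4 * (32 * t + 32 * κ * σ ^ 2) / lam := by
      rw [ht, Real.sqrt_div (Nat.cast_nonneg m)]
      ring
    rw [e]
    gcongr
    nlinarith [sq_nonneg σ]
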